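/- **Proposition 3.4.** For $k\ge 0$ put $r_k=\binom{k+2}{2}$ and $s_k=\binom{k+3}{3}$. For a finite sequence $H=(h_0,\dots,h_j)$ (with $h_i=0$ for $i<0$ and $i>j$) let $(\Delta H)_i=h_i-h_{i-1}$. A sequence $(d_0,\dots,d_m)$ of non-negative integers is a *Macaulay sequence* if $d_0=1$ and, for $1\le a<m$, writing $d_a=\sum_{i=1}^a\binom{n_i}{i}$ with $n_a>\dots>n_1\ge 0$, one has $d_{a+1}\le\sum_{i=1}^a\binom{n_i+1}{i+1}$. A sequence $H=(h_0,\dots,h_j)$ with $h_0=1$, $h_1=r$, $h_j\neq 0$ is an *SI sequence* of codimension $r$ and socle degree $j$ if $h_i=h_{j-i}$ for all $i$ and $(\Delta H)_{\le j/2}$ is a Macaulay sequence. It is a *codimension $r$ Gorenstein sequence* over a field $\mathbb F$ if it is the Hilbert function of a graded Artinian Gorenstein quotient of $\mathbb F[x_1,\dots,x_r]$ and $h_1=r$. It is *log-concave in degree* $i$ if $h_{i-1}h_{i+1}\le h_i^2$. Let $\mathbb F$ be an infinite field and let $\delta,k,b$ be non-negative integers such that $\delta s_k>b^2$ and such that the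 symmetric sequence $H$ of socle degree $2k+4$ with $(\Delta H)_{\le k+2}=(1,3,6,\dots,r_k,b,b+\delta)$, so that $$(h_k,\dots,h_{k+4})=(s_k,\ s_k+b,\ s_k+2b+\delta,\ s_k+b,\ s_k),$$ is an SI sequence of codimension four. Let $\ell$ be a positive integer and let $H'(\ell)=(h'_0,h'_1,\dots)$ be the sequence, symmetric about degree $k+\ell+2$, with $$(\Delta H'(\ell))_{\le k+\ell+2}=(1,3,6,\dots,r_k,\ b,\ b+\delta,\ b+2\delta,\ \dots,\ b+(\ell+1)\delta).$$ Then: 1. $H'(\ell)$ agrees with $H$ in degrees $0,\dots,k+2$; it is an SI sequence and a Gorenstein sequence over $\mathbb F$, of codimension four and socle degree $2k+4+2\ell$; and $h'_{k+u}=s_k+bu+\delta\,(1+2+\dots+(u-1))$ for $1\le u\le \ell+2$. 2. If $\delta=1$, then for $0\le u\le\ell$ $$D_u:=h'_{k+u}\,h'_{k+u+2}-(h'_{k+u+1})^2=s_k-b^2-\big((b+1)+(b+2)+\dots+(b+u)\big);$$ in particular the first differences $D_{u+1}-D_u=-(b+u+1)$, $0\le u<\ell$, are linear in $u$. 3. If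 $\delta=1$ and $b\ell+\frac{\ell(\ell+1)}{2}<s_k-b^2$, then $H'(\ell)$ fails to be log-concave in each of the consecutive degrees $k+1,k+2,\dots,k+\ell+1$. -/

import Mathlib

noncomputable section

namespace GorSeq

/-! ### Macaulay sequences and SI sequences -/

/-- `h = ∑_{i=1}^a binom (n_i) i` with `n_a > ⋯ > n_1 ≥ 0`: the Macaulay expansion of `h` in
degree `a` (it exists and is unique for `a ≥ 1` and `h ≥ 0`). -/
def IsMacaulayExpansion (a : ℕ) (n : ℕ → ℕ) (h : ℤ) : Prop :=
  StrictMonoOn n (Set.Icc 1 a) ∧ h = ∑ i ∈ Finset.Icc 1 a, ((n i).choose i : ℤ)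

/-- The finite sequence `(d_0, …, d_m)` is a Macaulay sequence: it consists of non-negative
integers, `d_0 = 1`, and `d_{a+1} ≤ d_a^{(a)} = ∑_{i=1}^a binom (n_i + 1) (i + 1)` for
`1 ≤ a < m`. -/
def IsMacaulaySequence (m : ℕ) (d : ℕ → ℤ) : Prop :=
  d 0 = 1 ∧ (∀ i ≤ m, 0 ≤ d i) ∧
    ∀ a, 1 ≤ a → a < m → ∃ n : ℕ → ℕ, IsMacaulayExpansion a n (d a) ∧
      d (a + 1) ≤ ∑ i ∈ Finset.Icc 1 a, ((n i + 1).choose (i + 1) : ℤ)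

/-- The first difference `(ΔH)_i = h_i - h_{i-1}`, with `h_{-1} = 0`. -/
def firstDiff (H : ℕ → ℕ) : ℕ → ℤ
  | 0 => H 0
  | i + 1 => (H (i + 1) : ℤ) - H i

/-- `(h_0, …, h_j)` has socle degree `j`: the highest degree of a non-zero entry. Finite sequences
are extended by zero. -/
def HasSocleDegree (H : ℕ → ℕ) (j : ℕ) : Prop :=
  H j ≠ 0 ∧ ∀ i, j < i → H i = 0

/-- `H = (1, r, …, r, 1_j)` is an SI sequence of codimension `r` and socle degree `j`. -/
def IsSISequence (r j : ℕ) (H : ℕ → ℕ) : Prop :=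
  HasSocleDegree H j ∧ H 0 = 1 ∧ H 1 = r ∧ (∀ i ≤ j, H i = H (j - i)) ∧
    IsMacaulaySequence (j / 2) (firstDiff H)

/-- Log-concavity in degree `i`. -/
def LogConcaveAt (H : ℕ → ℕ) (i : ℕ) : Prop :=
  H (i - 1) * H (i + 1) ≤ H i ^ 2

/-! ### Gorenstein sequences -/

section Algebra

attribute [local instance] MvPolynomial.gradedAlgebra

variable {F : Type*} [Field F] {r : ℕ}

/-- The Hilbert function of `A = F[x_1, …, x_r] / I`: the dimension of the image `A_i` of the forms
of degree `i`. -/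
def hilbertFunction (I : Ideal (MvPolynomial (Fin r) F)) (i : ℕ) : ℕ :=
  Module.finrank F
    ((MvPolynomial.homogeneousSubmodule (Fin r) F i).map (Ideal.Quotient.mkₐ F I).toLinearMap)

/-- The socle `(0 : 𝔪_A)` of `A = F[x_1, …, x_r] / I`, where `𝔪_A` is generated by the classes of
the variables. -/
def socle (I : Ideal (MvPolynomial (Fin r) F)) : Submodule F (MvPolynomial (Fin r) F ⧸ I) :=
  ⨅ i : Fin r, LinearMap.ker (LinearMap.mulLeft F (Ideal.Quotient.mk I (MvPolynomial.X i)))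

/-- `F[x_1, …, x_r] / I` is a standard graded Artinian Gorenstein algebra: `I` is homogeneous, the
quotient is Artinian, and its socle is one-dimensional. -/
def IsGradedArtinianGorenstein (I : Ideal (MvPolynomial (Fin r) F)) : Prop :=
  I.IsHomogeneous (MvPolynomial.homogeneousSubmodule (Fin r) F) ∧
    IsArtinianRing (MvPolynomial (Fin r) F ⧸ I) ∧ Module.finrank F (socle I) = 1

end Algebra

/-- `H` is a codimension `r` Gorenstein sequence over `F`: the Hilbert function of a graded Artinian
Gorenstein quotient of `F[x_1, …, x_r]` with `h_1 = r`. -/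
def IsGorensteinSequence (F : Type*) [Field F] (r : ℕ) (H : ℕ → ℕ) : Prop :=
  H 1 = r ∧ ∃ I : Ideal (MvPolynomial (Fin r) F),
    IsGradedArtinianGorenstein I ∧ ∀ i, hilbertFunction I i = H i

/-! ### The sequences `H` and `H'(ℓ)` -/

/-- The sequence of socle degree `2 m` that is symmetric about degree `m` and whose first difference
in degrees `0, …, m` is `d`. -/
def symSeq (m : ℕ) (d : ℕ → ℕ) (i : ℕ) : ℕ :=
  if i ≤ m then ∑ t ∈ Finset.range (i + 1), d t
  else if i ≤ 2 * m then ∑ t ∈ Finset.range (2 * m - i + 1), d t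
  else 0

/-- `s_k = binom (k + 3) 3`, the dimension of the forms of degree `k` in four variables. -/
def s (k : ℕ) : ℕ := (k + 3).choose 3

/-- `(1, 3, …, r_k, b, b + δ)` in degrees `0, …, k + 2`, where `r_t = binom (t + 2) 2`. -/
def baseDiff (δ k b t : ℕ) : ℕ :=
  if t ≤ k then (t + 2).choose 2 else if t = k + 1 then b else b + δ

/-- The sequence `H = (1, 4, …, s_k, s_k + b, s_k + 2b + δ, s_k + b, s_k, …, 4, 1)` of socle degree
`2k + 4`. -/
def baseSeq (δ k b : ℕ) : ℕ → ℕ := symSeq (k + 2) (baseDiff δ k b)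

/-- `(1, 3, …, r_k, b, b + δ, b + 2δ, …, b + (ℓ+1)δ)` in degrees `0, …, k + ℓ + 2`. -/
def extDiff (δ k b t : ℕ) : ℕ :=
  if t ≤ k then (t + 2).choose 2 else b + (t - (k + 1)) * δ

/-- The extended sequence `H'(ℓ)`, symmetric of socle degree `2k + 4 + 2ℓ`. -/
def extSeq (δ k b ℓ : ℕ) : ℕ → ℕ := symSeq (k + ℓ + 2) (extDiff δ k b)

/-- `(δ, k, b)` is a triple that yields a codimension four SI sequence `H` of socle degree `2k + 4`
with `δ s_k > b²` (so that `H` is not log-concave in degree `k + 1`). -/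
def IsNonLogConcaveTriple (δ k b : ℕ) : Prop :=
  IsSISequence 4 (2 * k + 4) (baseSeq δ k b) ∧ b ^ 2 < δ * s k

end GorSeq

end

/-! The numerical assertions follow from the recursion `extSeq_succ`. When `δ = 1`, write `x` for
the entry in degree `k + u` and `c = b + u`: the next two entries are `x + c` and `x + 2c + 1`, so
the minor is `x - c ^ 2`. Passing from `u` to `u + 1` changes it by `-(b + u + 1)`.

The substance is that the sequence is SI and Gorenstein for every `ℓ`. Both follow from three
inequalities, extracted from the SI condition on `H` and `b ^ 2 < δ * s k` in
`IsNonLogConcaveTriple.bounds`: `δ ≤ k + 1`, `b < (k + 3).choose 2`, and `b` is at least the number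
of monomials of degree `k + 1` in three variables whose exponent in one chosen variable is less than
`δ`. The last holds because a Macaulay expansion with `n_i ≤ i + 1` grows by the number of indices
with `n_i = i + 1`; these are the top indices, and each contributes `i + 1` to the number
represented. Conversely, the inequalities persist in higher degrees and permit growth by `δ` there
(`exists_expansion`).

For the Gorenstein property, take an order ideal of monomials in three variables: all monomials up
to degree `k`, then `b` of them in degree `k + 1`, then exactly `δ` more in each subsequent degree.
This is possible because those `b` monomials may be chosen to contain the ones with last exponent
less than `δ`. Replacing each monomial by a grid point (a distraction) gives points in projective
three-space whose Hilbert function in degree `n` counts the monomials of degree at most `n`. If all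
these degrees are at most `m`, then summing the values of forms of degree `2 m` over the points is a
linear functional, and the Gorenstein quotient it defines has the symmetrized Hilbert function: for
complementary degrees `i` and `2 m - i`, evaluation is surjective in at least one of them, so the
pairing has the rank of evaluation in the other. -/

/-! ### Gorenstein algebras from linear functionals -/

namespace GorSeq

open MvPolynomial

section Functional

attribute [local instance] MvPolynomial.gradedAlgebra

variable {F : Type*} [Field F] {r : ℕ}

/-- The largest ideal on which the linear functional `φ` vanishes. -/
def functionalIdeal (φ : MvPolynomial (Fin r) F →ₗ[F] F) : Ideal (MvPolynomial (Fin r) F) where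
  carrier := {f | ∀ g, φ (f * g) = 0}
  add_mem' hf hg h := by rw [add_mul, map_add, hf h, hg h, add_zero]
  zero_mem' h := by simp
  smul_mem' c f hf g := by rw [smul_eq_mul, mul_comm c f, mul_assoc]; exact hf _

/-- The functional `φ` vanishes on all forms of degree different from `j`. -/
def ConcentratedIn (j : ℕ) (φ : MvPolynomial (Fin r) F →ₗ[F] F) : Prop :=
  ∀ n, n ≠ j → ∀ f : MvPolynomial (Fin r) F, f.IsHomogeneous n → φ f = 0

variable {φ : MvPolynomial (Fin r) F →ₗ[F] F} {j : ℕ}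

lemma ConcentratedIn.map_mul (hφ : ConcentratedIn j φ) {i n : ℕ} (hin : i + n = j)
    (f : MvPolynomial (Fin r) F) {g : MvPolynomial (Fin r) F} (hg : g.IsHomogeneous n) :
    φ (f * g) = φ (homogeneousComponent i f * g) := by
  conv_lhs => rw [← sum_homogeneousComponent f]
  rw [Finset.sum_mul, map_sum]
  apply Finset.sum_eq_single i
  · intro a _ hai
    exact hφ (a + n) (by omega) _ ((homogeneousComponent_isHomogeneous a f).mul hg)
  · intro hi
    rw [homogeneousComponent_eq_zero i f (by simpa using hi)]
    simp

lemma ConcentratedIn.map_mul_eq_zero (hφ : ConcentratedIn j φ) {n : ℕ} (hn : j < n)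
    (f : MvPolynomial (Fin r) F) {g : MvPolynomial (Fin r) F} (hg : g.IsHomogeneous n) :
    φ (f * g) = 0 := by
  rw [← sum_homogeneousComponent f, Finset.sum_mul, map_sum]
  exact Finset.sum_eq_zero fun a _ =>
    hφ (a + n) (by omega) _ ((homogeneousComponent_isHomogeneous a f).mul hg)

/-- Only products of total degree `j` are seen by `φ`, so membership is tested one component at a
time; homogeneity of the ideal comes from this. -/
lemma ConcentratedIn.mem_iff (hφ : ConcentratedIn j φ) {f : MvPolynomial (Fin r) F} :
    f ∈ functionalIdeal φ ↔ ∀ i n, i + n = j → ∀ g : MvPolynomial (Fin r) F, g.IsHomogeneous n →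
      φ (homogeneousComponent i f * g) = 0 := by
  constructor
  · intro hf i n hin g hg
    rw [← hφ.map_mul hin f hg]
    exact hf g
  · intro h g
    rw [← sum_homogeneousComponent g, Finset.mul_sum, map_sum]
    refine Finset.sum_eq_zero fun n _ => ?_
    rcases le_or_gt n j with hn | hn
    · rw [hφ.map_mul (Nat.sub_add_cancel hn) f (homogeneousComponent_isHomogeneous n g)]
      exact h _ _ (Nat.sub_add_cancel hn) _ (homogeneousComponent_isHomogeneous n g)
    · exact hφ.map_mul_eq_zero hn f (homogeneousComponent_isHomogeneous n g)

lemma ConcentratedIn.mem_of_gt (hφ : ConcentratedIn j φ) {i : ℕ} (hi : j < i)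
    {f : MvPolynomial (Fin r) F} (hf : f.IsHomogeneous i) : f ∈ functionalIdeal φ := by
  intro g
  rw [mul_comm]
  exact hφ.map_mul_eq_zero hi g hf

lemma ConcentratedIn.mem_iff_of_isHomogeneous (hφ : ConcentratedIn j φ) {i n : ℕ} (hin : i + n = j)
    {f : MvPolynomial (Fin r) F} (hf : f.IsHomogeneous i) :
    f ∈ functionalIdeal φ ↔ ∀ g : MvPolynomial (Fin r) F, g.IsHomogeneous n → φ (f * g) = 0 := by
  refine ⟨fun h g _ => h g, fun h => hφ.mem_iff.2 fun a c hac g hg => ?_⟩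
  rw [homogeneousComponent_of_mem hf]
  split_ifs with hai
  · obtain rfl : c = n := by omega
    exact h g hg
  · simp

lemma ConcentratedIn.homogeneousComponent_mem (hφ : ConcentratedIn j φ) (i : ℕ)
    {f : MvPolynomial (Fin r) F} (hf : f ∈ functionalIdeal φ) :
    homogeneousComponent i f ∈ functionalIdeal φ := by
  rcases le_or_gt i j with hi | hi
  · rw [hφ.mem_iff_of_isHomogeneous (Nat.add_sub_cancel' hi)
      (homogeneousComponent_isHomogeneous i f)]
    intro g hg
    exact hφ.mem_iff.1 hf _ _ (Nat.add_sub_cancel' hi) g hg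
  · exact hφ.mem_of_gt hi (homogeneousComponent_isHomogeneous i f)

lemma ConcentratedIn.isHomogeneous (hφ : ConcentratedIn j φ) :
    (functionalIdeal φ).IsHomogeneous (homogeneousSubmodule (Fin r) F) := by
  intro i f hf
  have := hφ.homogeneousComponent_mem i hf
  rwa [← decomposition.decompose'_apply] at this

lemma ConcentratedIn.finite_quotient (hφ : ConcentratedIn j φ) :
    Module.Finite F (MvPolynomial (Fin r) F ⧸ functionalIdeal φ) := by
  let q := (Ideal.Quotient.mkₐ F (functionalIdeal φ)).toLinearMap
  refine Module.Finite.of_surjective (q ∘ₗ (restrictTotalDegree (Fin r) F j).subtype) fun x => ?_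
  obtain ⟨f, rfl⟩ := Ideal.Quotient.mk_surjective x
  -- Forms of degree above `j` lie in the ideal, so truncation at degree `j` does not change the
  -- class.
  refine ⟨⟨∑ i ∈ Finset.range (j + 1), homogeneousComponent i f, ?_⟩, ?_⟩
  · refine Submodule.sum_mem _ fun i hi => ?_
    rw [mem_restrictTotalDegree]
    exact (homogeneousComponent_isHomogeneous i f).totalDegree_le.trans
      (Nat.lt_succ_iff.1 (Finset.mem_range.1 hi))
  · change Ideal.Quotient.mk _ _ = Ideal.Quotient.mk _ _
    rw [Ideal.Quotient.eq, hφ.mem_iff]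
    intro i n hin g hg
    have : homogeneousComponent i (∑ a ∈ Finset.range (j + 1), homogeneousComponent a f - f)
        = 0 := by
      rw [map_sub, map_sum, Finset.sum_eq_single i]
      · rw [homogeneousComponent_eq_self (homogeneousComponent_isHomogeneous i f), sub_self]
      · intro a _ hai
        rw [homogeneousComponent_of_mem (homogeneousComponent_isHomogeneous a f), if_neg hai.symm]
      · intro h
        exact absurd (Finset.mem_range.2 (by omega)) h
    rw [Submodule.subtype_apply, this]
    simp

/-- A polynomial whose products with all variables lie in the ideal pairs with `g` through the
constant coefficient of `g` only. -/
lemma map_mul_of_forall_X_mul_mem {f : MvPolynomial (Fin r) F}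
    (hf : ∀ i, X i * f ∈ functionalIdeal φ) (g : MvPolynomial (Fin r) F) :
    φ (f * g) = coeff 0 g * φ f := by
  induction g using MvPolynomial.induction_on with
  | C a => simp [mul_comm f, ← smul_eq_C_mul]
  | add p q hp hq => rw [mul_add, map_add, hp, hq, coeff_add, add_mul]
  | mul_X p i _ =>
    have h := hf i p
    rw [show f * (p * X i) = X i * f * p by ring, h,
      ← constantCoeff_eq]
    simp

/-- A socle element `f` satisfies `φ (f * g) = g(0) φ(f)`, so its class is determined by the scalar
`φ f`. Any form of degree `j` with non-zero value therefore spans the socle. -/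
lemma ConcentratedIn.finrank_socle (hφ : ConcentratedIn j φ)
    (hne : ∃ f : MvPolynomial (Fin r) F, f.IsHomogeneous j ∧ φ f ≠ 0) :
    Module.finrank F (socle (functionalIdeal φ)) = 1 := by
  obtain ⟨ω, hω, hφω⟩ := hne
  have mem_socle : ∀ f : MvPolynomial (Fin r) F,
      Ideal.Quotient.mk (functionalIdeal φ) f ∈ socle (functionalIdeal φ) ↔
        ∀ i, X i * f ∈ functionalIdeal φ := by
    intro f
    simp only [socle, Submodule.mem_iInf, LinearMap.mem_ker, LinearMap.mulLeft_apply]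
    exact forall_congr' fun i => by rw [← _root_.map_mul, Ideal.Quotient.eq_zero_iff_mem]
  have hωs : Ideal.Quotient.mk (functionalIdeal φ) ω ∈ socle (functionalIdeal φ) := by
    rw [mem_socle]
    exact fun i => hφ.mem_of_gt (i := 1 + j) (by omega) ((isHomogeneous_X F i).mul hω)
  refine finrank_eq_one (⟨_, hωs⟩ : socle (functionalIdeal φ)) ?_ ?_
  · intro h
    have h0 : ω ∈ functionalIdeal φ := Ideal.Quotient.eq_zero_iff_mem.1 (congrArg Subtype.val h)
    exact hφω (by simpa using h0 1)
  · rintro ⟨x, hx⟩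
    obtain ⟨f, rfl⟩ := Ideal.Quotient.mk_surjective x
    refine ⟨φ f / φ ω, Subtype.ext ?_⟩
    change (φ f / φ ω) • Ideal.Quotient.mk (functionalIdeal φ) ω = Ideal.Quotient.mk _ f
    rw [show (φ f / φ ω) • Ideal.Quotient.mk (functionalIdeal φ) ω
      = Ideal.Quotient.mk (functionalIdeal φ) ((φ f / φ ω) • ω) from rfl, Ideal.Quotient.eq]
    intro g
    rw [sub_mul, map_sub, smul_mul_assoc, map_smul,
      map_mul_of_forall_X_mul_mem ((mem_socle f).1 hx),
      map_mul_of_forall_X_mul_mem ((mem_socle ω).1 hωs), smul_eq_mul]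
    field_simp
    ring

lemma ConcentratedIn.isGradedArtinianGorenstein (hφ : ConcentratedIn j φ)
    (hne : ∃ f : MvPolynomial (Fin r) F, f.IsHomogeneous j ∧ φ f ≠ 0) :
    IsGradedArtinianGorenstein (functionalIdeal φ) := by
  have := hφ.finite_quotient
  exact ⟨hφ.isHomogeneous, IsArtinianRing.of_finite F _, hφ.finrank_socle hne⟩

end Functional

/-! ### Hilbert functions as ranks of linear maps -/

lemma finrank_range_eq_of_ker_eq {F V W W' : Type*} [Field F] [AddCommGroup V] [Module F V]
    [AddCommGroup W] [Module F W] [AddCommGroup W'] [Module F W'] {f : V →ₗ[F] W} {g : V →ₗ[F] W'}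
    (h : LinearMap.ker f = LinearMap.ker g) :
    Module.finrank F (LinearMap.range f) = Module.finrank F (LinearMap.range g) :=
  (f.quotKerEquivRange.symm.trans
    ((Submodule.quotEquivOfEq _ _ h).trans g.quotKerEquivRange)).finrank_eq

lemma hilbertFunction_eq_finrank_range {F W : Type*} [Field F] [AddCommGroup W] [Module F W] {r : ℕ}
    {I : Ideal (MvPolynomial (Fin r) F)} {i : ℕ} (g : homogeneousSubmodule (Fin r) F i →ₗ[F] W)
    (h : ∀ f, g f = 0 ↔ (f : MvPolynomial (Fin r) F) ∈ I) :
    hilbertFunction I i = Module.finrank F (LinearMap.range g) := by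
  have hr : (homogeneousSubmodule (Fin r) F i).map (Ideal.Quotient.mkₐ F I).toLinearMap =
      LinearMap.range ((Ideal.Quotient.mkₐ F I).toLinearMap ∘ₗ
        (homogeneousSubmodule (Fin r) F i).subtype) := by
    rw [LinearMap.range_comp, Submodule.range_subtype]
  rw [hilbertFunction, hr]
  refine finrank_range_eq_of_ker_eq ?_
  ext f
  rw [LinearMap.mem_ker, LinearMap.mem_ker, h]
  exact Ideal.Quotient.eq_zero_iff_mem

/-! ### Gorenstein algebras from finite sets of points -/

section Points

variable {F : Type*} [Field F] {r : ℕ} {ι : Type*}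

/-- Evaluation of forms of degree `n` at the points `p`. -/
noncomputable def evalForms (p : ι → Fin r → F) (n : ℕ) :
    homogeneousSubmodule (Fin r) F n →ₗ[F] (ι → F) :=
  LinearMap.pi fun v => (aeval (p v)).toLinearMap ∘ₗ (homogeneousSubmodule (Fin r) F n).subtype

@[simp]
lemma evalForms_apply (p : ι → Fin r → F) (n : ℕ) (f : homogeneousSubmodule (Fin r) F n) (v : ι) :
    evalForms p n f v = eval (p v) (f : MvPolynomial (Fin r) F) := by
  simp [evalForms, aeval_eq_eval]

variable [Fintype ι]

/-- The sum of the values of the degree `j` component at the points `p`. -/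
noncomputable def pointFunctional (p : ι → Fin r → F) (j : ℕ) : MvPolynomial (Fin r) F →ₗ[F] F :=
  ∑ v, (aeval (p v)).toLinearMap ∘ₗ homogeneousComponent j

lemma pointFunctional_apply (p : ι → Fin r → F) (j : ℕ) (f : MvPolynomial (Fin r) F) :
    pointFunctional p j f = ∑ v, eval (p v) (homogeneousComponent j f) := by
  simp [pointFunctional, aeval_eq_eval]

lemma concentratedIn_pointFunctional (p : ι → Fin r → F) (j : ℕ) :
    ConcentratedIn j (pointFunctional p j) := by
  intro n hn f hf
  rw [pointFunctional_apply, homogeneousComponent_of_mem hf, if_neg hn.symm]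
  simp

lemma pointFunctional_mul (p : ι → Fin r → F) {i n j : ℕ} (hin : i + n = j)
    (f : homogeneousSubmodule (Fin r) F i) (g : homogeneousSubmodule (Fin r) F n) :
    pointFunctional p j (f * g) = ∑ v, evalForms p i f v * evalForms p n g v := by
  subst hin
  rw [pointFunctional_apply, homogeneousComponent_eq_self (IsHomogeneous.mul f.2 g.2)]
  simp

/-- The pairing of forms of degree `i` with forms of degree `n` by summing over points. -/
noncomputable def pointPairing [DecidableEq ι] (p : ι → Fin r → F) (i n : ℕ) :
    homogeneousSubmodule (Fin r) F i →ₗ[F] Module.Dual F (homogeneousSubmodule (Fin r) F n) :=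
  (evalForms p n).dualMap ∘ₗ (dotProductEquiv F ι).toLinearMap ∘ₗ evalForms p i

lemma pointPairing_apply [DecidableEq ι] (p : ι → Fin r → F) (i n : ℕ)
    (f : homogeneousSubmodule (Fin r) F i) (g : homogeneousSubmodule (Fin r) F n) :
    pointPairing p i n f g = ∑ v, evalForms p i f v * evalForms p n g v := rfl

lemma hilbertFunction_pointFunctional [DecidableEq ι] (p : ι → Fin r → F) {i n j : ℕ}
    (hin : i + n = j) :
    hilbertFunction (functionalIdeal (pointFunctional p j)) i =
      Module.finrank F (LinearMap.range (pointPairing p i n)) := by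
  refine hilbertFunction_eq_finrank_range _ fun f => ?_
  rw [(concentratedIn_pointFunctional p j).mem_iff_of_isHomogeneous hin f.2]
  constructor
  · intro h g hg
    have := pointFunctional_mul p hin f ⟨g, hg⟩
    rw [← pointPairing_apply, h] at this
    exact this
  · intro h
    ext g
    rw [pointPairing_apply, ← pointFunctional_mul p hin]
    exact h g g.2

/-- The pairing factors through the perfect dot product on `ι → F`; the transpose of a surjective
evaluation is injective and does not affect the kernel. -/
lemma finrank_range_pointPairing_of_right [DecidableEq ι] (p : ι → Fin r → F) (i n : ℕ)
    (h : Function.Surjective (evalForms p n)) :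
    Module.finrank F (LinearMap.range (pointPairing p i n)) =
      Module.finrank F (LinearMap.range (evalForms p i)) := by
  refine finrank_range_eq_of_ker_eq ?_
  rw [pointPairing, ← LinearMap.comp_assoc]
  refine LinearMap.ker_comp_of_ker_eq_bot _ (LinearMap.ker_eq_bot.2 ?_)
  exact (LinearMap.dualMap_injective_of_surjective h).comp (dotProductEquiv F ι).injective

lemma finrank_range_pointPairing_of_left [DecidableEq ι] (p : ι → Fin r → F) (i n : ℕ)
    (h : Function.Surjective (evalForms p i)) :
    Module.finrank F (LinearMap.range (pointPairing p i n)) =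
      Module.finrank F (LinearMap.range (evalForms p n)) := by
  rw [← LinearMap.finrank_range_dualMap_eq_finrank_range (evalForms p n), pointPairing,
    LinearMap.range_comp_of_range_eq_top]
  exact LinearMap.range_eq_top.2 ((dotProductEquiv F ι).surjective.comp h)

/-- A finite non-empty set of points whose Hilbert function reaches its final value in degree `m`
yields a Gorenstein algebra of socle degree `2 m` whose Hilbert function is the symmetrization. -/
theorem exists_gorenstein_of_points [Nonempty ι] (p : ι → Fin r → F) (m : ℕ)
    (h : ∀ n, m ≤ n → Function.Surjective (evalForms p n)) :
    ∃ I : Ideal (MvPolynomial (Fin r) F), IsGradedArtinianGorenstein I ∧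
      (∀ i ≤ m, hilbertFunction I i = Module.finrank F (LinearMap.range (evalForms p i))) ∧
      (∀ i, m < i → i ≤ 2 * m →
        hilbertFunction I i = Module.finrank F (LinearMap.range (evalForms p (2 * m - i)))) ∧
      ∀ i, 2 * m < i → hilbertFunction I i = 0 := by
  classical
  have hc := concentratedIn_pointFunctional p (2 * m)
  refine ⟨functionalIdeal (pointFunctional p (2 * m)), hc.isGradedArtinianGorenstein ?_, ?_, ?_, ?_⟩
  · obtain ⟨v⟩ := ‹Nonempty ι›
    -- A form that is `1` at one point and `0` at the others has functional value `1`.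
    obtain ⟨f, hf⟩ := h (2 * m) (by omega) (Pi.single v 1)
    refine ⟨f, f.2, ?_⟩
    rw [pointFunctional_apply, homogeneousComponent_eq_self f.2]
    simp_rw [← evalForms_apply, hf]
    simp
  · intro i hi
    rw [hilbertFunction_pointFunctional p (show i + (2 * m - i) = 2 * m by omega),
      finrank_range_pointPairing_of_right p _ _ (h _ (by omega))]
  · intro i hi hi'
    rw [hilbertFunction_pointFunctional p (show i + (2 * m - i) = 2 * m by omega),
      finrank_range_pointPairing_of_left p _ _ (h _ (by omega))]
  · intro i hi
    rw [hilbertFunction_eq_finrank_range (0 : homogeneousSubmodule (Fin r) F i →ₗ[F] F)]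
    · rw [LinearMap.range_zero, finrank_bot]
    · exact fun f => ⟨fun _ => hc.mem_of_gt hi f.2, fun _ => rfl⟩

end Points

end GorSeq

/-! ### Points from order ideals of monomials -/

namespace GorSeq

open MvPolynomial

section OrderIdeal

variable {F : Type*} [Field F] {r : ℕ}

/-- The point `(1 : α_{v_1} : ⋯ : α_{v_r})`. -/
def gridPoint (α : ℕ → F) (v : Fin r → ℕ) : Fin (r + 1) → F := Fin.cons 1 fun i => α (v i)

/-- The value at the grid point `v` of the product of the linear forms `x_i - α_s x_0` for
`s < u_i`. -/
def gridValue (α : ℕ → F) (u v : Fin r → ℕ) : F :=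
  ∏ i, ∏ s ∈ Finset.range (u i), (α (v i) - α s)

lemma gridValue_eq_zero {α : ℕ → F} {u v : Fin r → ℕ} (h : ¬ u ≤ v) : gridValue α u v = 0 := by
  simp only [Pi.le_def, not_forall, not_le] at h
  obtain ⟨i, hi⟩ := h
  exact Finset.prod_eq_zero (Finset.mem_univ i)
    (Finset.prod_eq_zero (Finset.mem_range.2 hi) (sub_self _))

lemma gridValue_self_ne_zero {α : ℕ → F} (hα : Function.Injective α) (u : Fin r → ℕ) :
    gridValue α u u ≠ 0 := by
  refine Finset.prod_ne_zero_iff.2 fun i _ => Finset.prod_ne_zero_iff.2 fun s hs => ?_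
  rw [sub_ne_zero, hα.ne_iff]
  exact (Finset.mem_range.1 hs).ne'

/-- Write `α (v i) = (α (v i) - α (u i)) + α (u i)`; the first summand is the next factor of the
product. -/
lemma mul_gridValue (α : ℕ → F) (u v : Fin r → ℕ) (i : Fin r) :
    α (v i) * gridValue α u v =
      gridValue α (Function.update u i (u i + 1)) v + α (u i) * gridValue α u v := by
  have h : gridValue α (Function.update u i (u i + 1)) v =
      gridValue α u v * (α (v i) - α (u i)) := by
    unfold gridValue
    rw [← Finset.mul_prod_erase _ _ (Finset.mem_univ i),
      ← Finset.mul_prod_erase _ (fun a => ∏ s ∈ Finset.range (u a), (α (v a) - α s))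
        (Finset.mem_univ i), Function.update_self, Finset.prod_range_succ]
    have : ∏ a ∈ Finset.univ.erase i,
        ∏ s ∈ Finset.range (Function.update u i (u i + 1) a), (α (v a) - α s) =
        ∏ a ∈ Finset.univ.erase i, ∏ s ∈ Finset.range (u a), (α (v a) - α s) :=
      Finset.prod_congr rfl fun a ha => by
        rw [Function.update_of_ne (Finset.ne_of_mem_erase ha)]
    rw [this]
    ring
  rw [h]
  ring

lemma sum_update_succ (u : Fin r → ℕ) (i : Fin r) :
    ∑ a, Function.update u i (u i + 1) a = ∑ a, u a + 1 := by
  rw [Finset.sum_update_of_mem (Finset.mem_univ i),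
    ← Finset.add_sum_erase _ _ (Finset.mem_univ i), Finset.sdiff_singleton_eq_erase]
  ring

variable (α : ℕ → F) (M : Finset (Fin r → ℕ))

/-- The space of functions on the grid points of `M` spanned by the `gridValue α u`, where `u` has
degree at most `n`. -/
def gridSpan (n : ℕ) : Submodule F (M → F) :=
  Submodule.span F ((fun (u : Fin r → ℕ) (v : M) => gridValue α u v) '' {u | ∑ i, u i ≤ n})

variable {α M}

lemma gridValue_mem_gridSpan {n : ℕ} {u : Fin r → ℕ} (hu : ∑ i, u i ≤ n) :
    (fun v : M => gridValue α u v) ∈ gridSpan α M n :=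
  Submodule.subset_span ⟨u, hu, rfl⟩

lemma mul_mem_gridSpan (i : Fin r) {n : ℕ} {w : M → F} (hw : w ∈ gridSpan α M n) :
    (fun v : M => α (v.1 i) * w v) ∈ gridSpan α M (n + 1) := by
  induction hw using Submodule.span_induction with
  | mem x hx =>
    obtain ⟨u, hu, rfl⟩ := hx
    have : (fun v : M => α (v.1 i) * gridValue α u v) =
        (fun v : M => gridValue α (Function.update u i (u i + 1)) v) +
          α (u i) • fun v : M => gridValue α u v := by
      ext v
      simp [mul_gridValue]
    rw [this]
    refine Submodule.add_mem _ (gridValue_mem_gridSpan ?_)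
      (Submodule.smul_mem _ _ (gridValue_mem_gridSpan ?_))
    · rw [sum_update_succ]
      exact Nat.succ_le_succ hu
    · exact le_trans hu (Nat.le_succ n)
  | zero =>
    convert Submodule.zero_mem (gridSpan α M (n + 1)) using 1
    ext v
    simp
  | add x y _ _ hx hy =>
    convert Submodule.add_mem _ hx hy using 1
    ext v
    simp [mul_add]
  | smul a x _ hx =>
    convert Submodule.smul_mem _ a hx using 1
    ext v
    simp [mul_left_comm]

lemma gridSpan_mono {m n : ℕ} (h : m ≤ n) : gridSpan α M m ≤ gridSpan α M n :=
  Submodule.span_mono (Set.image_mono fun _ hu => le_trans hu h)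

/-- Multiplication by an affine coordinate raises the filtration `gridSpan` by at most one, and the
homogenizing variable takes the value `1` at every grid point. -/
lemma eval_monomial_mem_gridSpan {n : ℕ} {d : Fin (r + 1) →₀ ℕ} (hd : d.degree = n) :
    (fun v : M => eval (gridPoint α v.1) (monomial d (1 : F))) ∈ gridSpan α M n := by
  induction n generalizing d with
  | zero =>
    obtain rfl := (Finsupp.degree_eq_zero_iff d).1 hd
    convert gridValue_mem_gridSpan (α := α) (M := M) (u := 0) (n := 0) (by simp) using 1
    ext v
    simp [gridValue]
  | succ n ih =>
    obtain ⟨i, hi⟩ : ∃ i, d i ≠ 0 := by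
      by_contra! h
      have : d = 0 := Finsupp.ext h
      simp [this] at hd
    obtain ⟨e, rfl⟩ : ∃ e, d = e + Finsupp.single i 1 :=
      ⟨d - Finsupp.single i 1, (Finsupp.sub_add_single_one_cancel hi).symm⟩
    have he := ih (d := e) (by simpa using hd)
    simp only [monomial_add_single, pow_one, map_mul, eval_X]
    cases i using Fin.cases with
    | zero => simpa [gridPoint] using gridSpan_mono (Nat.le_succ n) he
    | succ i => simpa [gridPoint, mul_comm] using mul_mem_gridSpan i he

lemma range_evalForms_gridPoint (n : ℕ) :
    LinearMap.range (evalForms (fun v : M => gridPoint α v.1) n) = gridSpan α M n := by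
  refine le_antisymm ?_ ?_
  · rintro _ ⟨f, rfl⟩
    have : evalForms (fun v : M => gridPoint α v.1) n f = ∑ d ∈ f.1.support,
        coeff d f.1 • fun v : M => eval (gridPoint α v.1) (monomial d (1 : F)) := by
      ext v
      rw [evalForms_apply]
      conv_lhs => rw [← f.1.support_sum_monomial_coeff]
      rw [map_sum]
      simp [eval_monomial]
    rw [this]
    refine Submodule.sum_mem _ fun d hd => Submodule.smul_mem _ _ ?_
    have hdeg : d.degree = n := by
      by_contra h
      exact mem_support_iff.1 hd (IsHomogeneous.coeff_eq_zero f.2 h)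
    exact eval_monomial_mem_gridSpan hdeg
  · rw [gridSpan, Submodule.span_le]
    rintro _ ⟨u, hu, rfl⟩
    -- The product of linear forms behind `gridValue`, brought up to degree `n` by a power of `X 0`.
    let g : MvPolynomial (Fin (r + 1)) F :=
      (∏ i, ∏ s ∈ Finset.range (u i), (X i.succ - C (α s) * X 0)) * X 0 ^ (n - ∑ i, u i)
    have hg : g.IsHomogeneous n := by
      have h1 : (∏ i, ∏ s ∈ Finset.range (u i), (X i.succ - C (α s) * X 0) :
          MvPolynomial (Fin (r + 1)) F).IsHomogeneous (∑ i, u i) := by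
        refine IsHomogeneous.prod _ _ _ fun i _ => ?_
        have := IsHomogeneous.prod (Finset.range (u i))
          (fun s => (X i.succ - C (α s) * X 0 : MvPolynomial (Fin (r + 1)) F)) (fun _ => 1)
          fun s _ => (isHomogeneous_X F _).sub (isHomogeneous_C_mul_X _ _)
        simpa using this
      have h2 := h1.mul (isHomogeneous_X_pow (R := F) (0 : Fin (r + 1)) (n - ∑ i, u i))
      rwa [Nat.add_sub_cancel' hu] at h2
    refine ⟨⟨g, hg⟩, ?_⟩
    ext v
    simp [g, gridPoint, gridValue]

/-- For `u` outside the lower set `M`, no `v ∈ M` has `u ≤ v`, so `gridValue α u` vanishes on all of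
`M`. -/
lemma gridSpan_eq_span_filter (hM : IsLowerSet (M : Set (Fin r → ℕ))) (n : ℕ) :
    gridSpan α M n = Submodule.span F (Set.range
      fun (u : {u : M // ∑ i, u.1 i ≤ n}) (v : M) => gridValue α u.1.1 v.1) := by
  refine le_antisymm (Submodule.span_le.2 ?_) (Submodule.span_mono ?_)
  · rintro _ ⟨u, hu, rfl⟩
    by_cases huM : u ∈ M
    · exact Submodule.subset_span ⟨⟨⟨u, huM⟩, hu⟩, rfl⟩
    · have : (fun v : M => gridValue α u v) = 0 := by
        ext v
        exact gridValue_eq_zero fun h => huM (hM h v.2)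
      simp only [this]
      exact Submodule.zero_mem _
  · rintro _ ⟨u, rfl⟩
    exact ⟨u.1.1, u.2, rfl⟩

/-- The matrix of values is triangular for the product order with non-zero diagonal: evaluating a
relation at `w` leaves only indices `u ≤ w`, and those below `w` are removed by induction. -/
lemma linearIndependent_gridValue (hα : Function.Injective α) (n : ℕ) :
    LinearIndependent F
      fun (u : {u : M // ∑ i, u.1 i ≤ n}) (v : M) => gridValue α u.1.1 v.1 := by
  rw [Fintype.linearIndependent_iff]
  intro c hc
  have key : ∀ w : Fin r → ℕ, ∀ (hw : w ∈ M) (hn : ∑ i, w i ≤ n), c ⟨⟨w, hw⟩, hn⟩ = 0 := by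
    intro w
    induction w using WellFoundedLT.induction with
    | ind w ih =>
      intro hw hn
      have h := congrFun hc ⟨w, hw⟩
      simp only [Finset.sum_apply, Pi.smul_apply, smul_eq_mul, Pi.zero_apply] at h
      rw [Finset.sum_eq_single (⟨⟨w, hw⟩, hn⟩ : {u : M // ∑ i, u.1 i ≤ n})] at h
      · exact (mul_eq_zero.1 h).resolve_right (gridValue_self_ne_zero hα w)
      · rintro ⟨⟨u, hu⟩, hun⟩ _ hne
        by_cases hle : u ≤ w
        · have hlt : u < w := lt_of_le_of_ne hle fun h => hne (by subst h; rfl)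
          rw [ih u hlt hu hun, zero_mul]
        · rw [gridValue_eq_zero hle, mul_zero]
      · simp
  exact fun u => key u.1.1 u.1.2 u.2

/-- The Hilbert function of the points attached to a finite order ideal `M` counts the elements of
`M` of degree at most `n`. -/
theorem finrank_range_evalForms_gridPoint (hα : Function.Injective α)
    (hM : IsLowerSet (M : Set (Fin r → ℕ))) (n : ℕ) :
    Module.finrank F (LinearMap.range (evalForms (fun v : M => gridPoint α v.1) n)) =
      (M.filter fun u => ∑ i, u i ≤ n).card := by
  rw [range_evalForms_gridPoint, gridSpan_eq_span_filter hM,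
    finrank_span_eq_card (linearIndependent_gridValue hα n), Fintype.card_subtype,
    Finset.univ_eq_attach, ← Finset.card_map (Function.Embedding.subtype _)]
  congr 1
  ext u
  simp [and_comm]

/-- A finite order ideal of monomials in `r` variables of degree at most `m` yields a Gorenstein
algebra in `r + 1` variables. -/
theorem exists_gorenstein_of_orderIdeal [Infinite F] {m : ℕ} (hM : IsLowerSet (M : Set (Fin r → ℕ)))
    (hne : M.Nonempty) (hm : ∀ u ∈ M, ∑ i, u i ≤ m) :
    ∃ I : Ideal (MvPolynomial (Fin (r + 1)) F), IsGradedArtinianGorenstein I ∧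
      (∀ i ≤ m, hilbertFunction I i = (M.filter fun u => ∑ a, u a ≤ i).card) ∧
      (∀ i, m < i → i ≤ 2 * m →
        hilbertFunction I i = (M.filter fun u => ∑ a, u a ≤ 2 * m - i).card) ∧
      ∀ i, 2 * m < i → hilbertFunction I i = 0 := by
  have hα := (Infinite.natEmbedding F).injective
  have : Nonempty M := hne.to_subtype
  simp_rw [← finrank_range_evalForms_gridPoint hα hM]
  refine exists_gorenstein_of_points _ m fun n hn => ?_
  rw [← LinearMap.range_eq_top]
  refine Submodule.eq_top_of_finrank_eq ?_
  rw [finrank_range_evalForms_gridPoint hα hM, Module.finrank_fintype_fun_eq_card,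
    Fintype.card_coe, Finset.filter_true_of_mem fun u hu => (hm u hu).trans hn]

end OrderIdeal

end GorSeq

/-! ### Order ideals in three variables -/

namespace GorSeq

/-- Between two nested finite lower sets there are lower sets of every intermediate size. -/
lemma exists_isLowerSet_card_eq {β : Type*} [PartialOrder β] [DecidableEq β] {A B : Finset β}
    (hA : IsLowerSet (A : Set β)) (hB : IsLowerSet (B : Set β)) (hAB : A ⊆ B) {n : ℕ}
    (hn : A.card ≤ n) (hn' : n ≤ B.card) :
    ∃ L : Finset β, IsLowerSet (L : Set β) ∧ A ⊆ L ∧ L ⊆ B ∧ L.card = n := by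
  induction n, hn using Nat.le_induction with
  | base => exact ⟨A, hA, subset_rfl, hAB, rfl⟩
  | succ n hn ih =>
    obtain ⟨L, hL, hAL, hLB, hc⟩ := ih (by omega)
    -- Adjoining a minimal element of the complement keeps the set lower.
    obtain ⟨x, hx⟩ := (B \ L).exists_minimal
      (Finset.sdiff_nonempty.2 fun h => by have := Finset.card_le_card h; omega)
    have hxB := Finset.mem_sdiff.1 hx.prop
    refine ⟨insert x L, ?_, hAL.trans (Finset.subset_insert x L),
      Finset.insert_subset hxB.1 hLB, by rw [Finset.card_insert_of_notMem hxB.2, hc]⟩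
    intro y z hzy hy
    simp only [Finset.coe_insert, Set.mem_insert_iff, Finset.mem_coe] at hy ⊢
    rcases hy with rfl | hy
    · by_cases hz : z ∈ L
      · exact Or.inr hz
      · exact Or.inl (le_antisymm hzy
          (hx.le_of_le (Finset.mem_sdiff.2 ⟨hB hzy hxB.1, hz⟩) hzy))
    · exact Or.inr (hL hzy hy)

/-- The pairs `(y, z)` with `y + z ≤ t` and `z < δ`. -/
def slab (δ t : ℕ) : Finset (ℕ × ℕ) :=
  (Finset.range (t + 1) ×ˢ Finset.range δ).filter fun q => q.1 + q.2 ≤ t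

lemma mem_slab {δ t : ℕ} {q : ℕ × ℕ} : q ∈ slab δ t ↔ q.1 + q.2 ≤ t ∧ q.2 < δ := by
  simp only [slab, Finset.mem_filter, Finset.mem_product, Finset.mem_range]
  omega

lemma card_slab (δ t : ℕ) : (slab δ t).card = ∑ z ∈ Finset.range δ, (t + 1 - z) := by
  rw [Finset.card_eq_sum_card_fiberwise (f := Prod.snd) (t := Finset.range δ)
    fun q hq => by simpa using (mem_slab.1 hq).2]
  refine Finset.sum_congr rfl fun z hz => ?_
  rw [← Finset.card_range (t + 1 - z)]
  refine Finset.card_nbij' Prod.fst (fun y => (y, z)) ?_ ?_ ?_ ?_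
  · rintro ⟨y, w⟩ h
    simp only [Finset.coe_filter, mem_slab, Set.mem_ofPred_eq, Finset.coe_range, Set.mem_Iio] at h ⊢
    omega
  · intro y h
    simp only [Finset.coe_filter, mem_slab, Set.mem_ofPred_eq, Finset.coe_range, Set.mem_Iio,
      Finset.mem_range] at h hz ⊢
    exact ⟨⟨by omega, hz⟩, trivial⟩
  · rintro ⟨y, w⟩ h
    simp only [Finset.coe_filter, mem_slab, Set.mem_ofPred_eq] at h
    simp [h.2]
  · intro y _
    rfl

lemma sum_range_sub_self (t : ℕ) :
    ∑ z ∈ Finset.range (t + 1), (t + 1 - z) = (t + 2).choose 2 := by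
  induction t with
  | zero => rfl
  | succ t ih =>
    rw [Finset.sum_range_succ', Nat.choose_succ_succ' (t + 2) 1, Nat.choose_one_right, ← ih,
      add_comm]
    simp

lemma isLowerSet_slab (δ t : ℕ) : IsLowerSet (slab δ t : Set (ℕ × ℕ)) := by
  intro p q hqp hp
  simp only [Finset.mem_coe, mem_slab] at hp ⊢
  have := hqp.1
  have := hqp.2
  omega

/-- The set of monomials of degree `t ≤ m` whose exponents in the last two variables lie in `P t`. -/
def layeredSet (m : ℕ) (P : ℕ → Finset (ℕ × ℕ)) : Finset (Fin 3 → ℕ) :=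
  (Fintype.piFinset fun _ => Finset.range (m + 1)).filter fun u =>
    ∑ i, u i ≤ m ∧ (u 1, u 2) ∈ P (∑ i, u i)

lemma mem_layeredSet {m : ℕ} {P : ℕ → Finset (ℕ × ℕ)} {u : Fin 3 → ℕ} :
    u ∈ layeredSet m P ↔ ∑ i, u i ≤ m ∧ (u 1, u 2) ∈ P (∑ i, u i) := by
  simp only [layeredSet, Finset.mem_filter, Fintype.mem_piFinset, Finset.mem_range,
    and_iff_right_iff_imp]
  intro h i
  exact Nat.lt_succ_of_le ((Finset.single_le_sum (fun _ _ => Nat.zero_le _)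
    (Finset.mem_univ i)).trans h.1)

lemma card_filter_layeredSet {m : ℕ} {P : ℕ → Finset (ℕ × ℕ)} (hP : ∀ t, ∀ q ∈ P t, q.1 + q.2 ≤ t)
    {i : ℕ} (hi : i ≤ m) :
    ((layeredSet m P).filter fun u => ∑ a, u a ≤ i).card =
      ∑ t ∈ Finset.range (i + 1), (P t).card := by
  rw [Finset.card_eq_sum_card_fiberwise (f := fun u : Fin 3 → ℕ => ∑ a, u a)
    (t := Finset.range (i + 1)) fun u hu => by
      simpa [Nat.lt_succ_iff] using (Finset.mem_filter.1 hu).2]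
  refine Finset.sum_congr rfl fun t ht => ?_
  have ht' := Finset.mem_range.1 ht
  -- In fixed degree `t` the first exponent is recovered from the other two.
  refine Finset.card_nbij' (fun u => (u 1, u 2)) (fun q => ![t - q.1 - q.2, q.1, q.2]) ?_ ?_ ?_ ?_
  · intro u hu
    simp only [Finset.coe_filter, Finset.mem_filter, mem_layeredSet, Set.mem_ofPred_eq] at hu
    rw [← hu.2]
    exact hu.1.1.2
  · intro q hq
    have hs : ∑ a, ![t - q.1 - q.2, q.1, q.2] a = t := by
      have := hP t q hq
      simp only [Fin.sum_univ_three, Matrix.cons_val]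
      omega
    simp only [Finset.coe_filter, Finset.mem_filter, mem_layeredSet, Set.mem_ofPred_eq, hs]
    exact ⟨⟨⟨by omega, hq⟩, by omega⟩, trivial⟩
  · intro u hu
    simp only [Finset.coe_filter, Finset.mem_filter, mem_layeredSet, Set.mem_ofPred_eq,
      Fin.sum_univ_three] at hu
    funext a
    fin_cases a
    · simp only [Fin.zero_eta, Matrix.cons_val_zero]
      omega
    · rfl
    · rfl
  · intro q _
    rfl

/-- The exponents in the last two variables of the degree `t` part of an order ideal: all pairs if
`t ≤ k`, and otherwise the pairs that lie in `L`, or have sum exceeding `k + 1` and last entry less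
than `δ`. -/
def layer (δ k : ℕ) (L : Finset (ℕ × ℕ)) (t : ℕ) : Finset (ℕ × ℕ) :=
  if t ≤ k then slab (t + 1) t else L ∪ (slab δ t \ slab δ (k + 1))

lemma add_le_of_mem_layer {δ k : ℕ} {L : Finset (ℕ × ℕ)} (hL : L ⊆ slab (k + 2) (k + 1)) (t : ℕ)
    (q : ℕ × ℕ) (hq : q ∈ layer δ k L t) : q.1 + q.2 ≤ t := by
  unfold layer at hq
  split_ifs at hq with h
  · exact (mem_slab.1 hq).1
  · rcases Finset.mem_union.1 hq with hq | hq
    · have := (mem_slab.1 (hL hq)).1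
      omega
    · exact (mem_slab.1 (Finset.mem_sdiff.1 hq).1).1

/-- A divisor of degree at most `k` is always admitted. Above that degree, a divisor of a monomial
coming from `L` stays in `L`; a divisor of one with last exponent less than `δ` keeps that property,
and if its pair drops to sum at most `k + 1` it falls into `L`, since `L` contains the whole slab.
-/
lemma isLowerSet_layeredSet_layer {δ k m : ℕ} {L : Finset (ℕ × ℕ)}
    (hlow : IsLowerSet (L : Set (ℕ × ℕ))) (hδL : slab δ (k + 1) ⊆ L) :
    IsLowerSet (layeredSet m (layer δ k L) : Set (Fin 3 → ℕ)) := by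
  intro u v hvu hu
  simp only [Finset.mem_coe, mem_layeredSet] at hu ⊢
  have hsum : ∑ i, v i ≤ ∑ i, u i := Finset.sum_le_sum fun i _ => hvu i
  have h1 : v 1 ≤ u 1 := hvu 1
  have h2 : v 2 ≤ u 2 := hvu 2
  have hv : v 1 + v 2 ≤ ∑ i, v i := by
    rw [Fin.sum_univ_three]
    omega
  refine ⟨hsum.trans hu.1, ?_⟩
  by_cases hk : ∑ i, v i ≤ k
  · rw [layer, if_pos hk, mem_slab]
    omega
  · have huP := hu.2
    rw [layer, if_neg (by omega)] at huP
    rw [layer, if_neg hk]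
    rcases Finset.mem_union.1 huP with h | h
    · exact Finset.mem_union_left _ (hlow (show (v 1, v 2) ≤ (u 1, u 2) from ⟨h1, h2⟩) h)
    · have h := (mem_slab.1 (Finset.mem_sdiff.1 h).1).2
      by_cases hvs : (v 1, v 2) ∈ slab δ (k + 1)
      · exact Finset.mem_union_left _ (hδL hvs)
      · refine Finset.mem_union_right _ (Finset.mem_sdiff.2 ⟨mem_slab.2 ⟨hv, ?_⟩, hvs⟩)
        exact lt_of_le_of_lt h2 h

lemma card_layer {δ k b : ℕ} {L : Finset (ℕ × ℕ)} (hδ : δ ≤ k + 2) (hL : L ⊆ slab (k + 2) (k + 1))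
    (hb : L.card = b) (t : ℕ) :
    (layer δ k L t).card = extDiff δ k b t := by
  unfold layer extDiff
  split_ifs with h
  · rw [card_slab, sum_range_sub_self]
  · have hsub : slab δ (k + 1) ⊆ slab δ t := by
      intro q
      simp only [mem_slab]
      omega
    rw [Finset.card_union_of_disjoint, hb, Finset.card_sdiff_of_subset hsub, card_slab, card_slab]
    -- Since `δ ≤ k + 2`, no subtraction is truncated, so every `z < δ` gains one pair per degree.
    · have : ∑ z ∈ Finset.range δ, (t + 1 - z) =
          ∑ z ∈ Finset.range δ, (k + 1 + 1 - z) + (t - (k + 1)) * δ := by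
        rw [mul_comm, ← smul_eq_mul, ← Finset.card_range δ, ← Finset.sum_const,
          Finset.card_range, ← Finset.sum_add_distrib]
        refine Finset.sum_congr rfl fun z hz => ?_
        have := Finset.mem_range.1 hz
        omega
      omega
    · rw [Finset.disjoint_left]
      intro q hq hq'
      have h1 := mem_slab.1 (hL hq)
      rw [Finset.mem_sdiff, mem_slab, mem_slab] at hq'
      omega

/-- Sequences with eventually linear first difference, subject to the bounds of Macaulay's theorem,
are Gorenstein sequences. -/
theorem exists_gorenstein_extSeq (F : Type*) [Field F] [Infinite F] {δ k b : ℕ} (ℓ : ℕ)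
    (hδ : δ ≤ k + 2) (hb : b ≤ (k + 3).choose 2)
    (hbδ : ∑ z ∈ Finset.range δ, (k + 2 - z) ≤ b) :
    ∃ I : Ideal (MvPolynomial (Fin 4) F), IsGradedArtinianGorenstein I ∧
      ∀ i, hilbertFunction I i = extSeq δ k b ℓ i := by
  -- The bounds on `b` are exactly the sizes of the slab and of the full triangle between which `L`
  -- is chosen.
  obtain ⟨L, hlow, hδL, hL, hLb⟩ := exists_isLowerSet_card_eq (isLowerSet_slab δ (k + 1))
    (isLowerSet_slab (k + 2) (k + 1)) (fun q => by simp only [mem_slab]; omega) (n := b)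
    (by rwa [card_slab]) (by rwa [card_slab, sum_range_sub_self])
  obtain ⟨I, hI, h1, h2, h3⟩ := exists_gorenstein_of_orderIdeal (F := F) (m := k + ℓ + 2)
    (isLowerSet_layeredSet_layer (m := k + ℓ + 2) hlow hδL)
    ⟨0, mem_layeredSet.2 (by simp [layer, mem_slab])⟩ fun u hu => (mem_layeredSet.1 hu).1
  refine ⟨I, hI, fun i => ?_⟩
  simp only [extSeq, symSeq]
  have hcard : ∀ i ≤ k + ℓ + 2, _ := fun i hi =>
    card_filter_layeredSet (m := k + ℓ + 2) (add_le_of_mem_layer (δ := δ) hL) hi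
  simp only [card_layer hδ hL hLb] at hcard
  split_ifs with hi hi'
  · rw [h1 i hi, hcard i hi]
  · rw [h2 i (by omega) hi', hcard _ (by omega)]
  · exact h3 i (by omega)

end GorSeq

/-! ### Macaulay expansions -/

namespace GorSeq

/-- Equivalently, `n i - i` is weakly increasing: a bound on the excess of the leading term bounds
the excess of all terms. -/
lemma add_sub_le_of_strictMonoOn {a : ℕ} {n : ℕ → ℕ} (hn : StrictMonoOn n (Set.Icc 1 a)) {i : ℕ}
    (hi : 1 ≤ i) (hia : i ≤ a) : n i + (a - i) ≤ n a := by
  induction a, hia using Nat.le_induction with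
  | base => simp
  | succ a hia ih =>
    have h1 := ih (hn.mono (Set.Icc_subset_Icc_right (Nat.le_succ a)))
    have h2 := hn (show a ∈ Set.Icc 1 (a + 1) from ⟨by omega, by omega⟩)
      (show a + 1 ∈ Set.Icc 1 (a + 1) from ⟨by omega, le_rfl⟩) (Nat.lt_succ_self a)
    omega

lemma sum_choose_succ_succ (a : ℕ) (n : ℕ → ℕ) :
    ∑ i ∈ Finset.Icc 1 a, (n i + 1).choose (i + 1) =
      ∑ i ∈ Finset.Icc 1 a, (n i).choose i + ∑ i ∈ Finset.Icc 1 a, (n i).choose (i + 1) := by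
  rw [← Finset.sum_add_distrib]
  exact Finset.sum_congr rfl fun i _ => Nat.choose_succ_succ' _ _

lemma sum_range_succ_sub (a c : ℕ) :
    ∑ z ∈ Finset.range (c + 1), (a + 2 - z) = a + 2 + ∑ z ∈ Finset.range c, (a + 1 - z) := by
  rw [Finset.sum_range_succ', add_comm]
  simp

/-- If the Macaulay expansion has `n_i ≤ i + 1`, then the number of `i` with `n_i = i + 1`, which is
the largest possible growth, bounds the number represented from below. -/
lemma growth_le_of_le {a : ℕ} {n : ℕ → ℕ} (hn : StrictMonoOn n (Set.Icc 1 a)) (ha : n a ≤ a + 1) :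
    ∑ i ∈ Finset.Icc 1 a, (n i).choose (i + 1) ≤ a ∧
      ∑ z ∈ Finset.range (∑ i ∈ Finset.Icc 1 a, (n i).choose (i + 1)), (a + 1 - z) ≤
        ∑ i ∈ Finset.Icc 1 a, (n i).choose i := by
  induction a with
  | zero => simp
  | succ a ih =>
    rcases ha.lt_or_eq with h | h
    · have : ∑ i ∈ Finset.Icc 1 (a + 1), (n i).choose (i + 1) = 0 := by
        refine Finset.sum_eq_zero fun i hi => Nat.choose_eq_zero_of_lt ?_
        rw [Finset.mem_Icc] at hi
        have := add_sub_le_of_strictMonoOn hn hi.1 hi.2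
        omega
      simp [this]
    -- Now `n (a + 1) = a + 2`: the top term contributes `a + 2` to the value and `1` to the growth,
    -- and the rest is an expansion in degree `a`.
    · have hle : a = 0 ∨ n a ≤ a + 1 := by
        rcases Nat.eq_zero_or_pos a with h0 | h0
        · exact Or.inl h0
        · have := add_sub_le_of_strictMonoOn hn h0 (Nat.le_succ a)
          omega
      have hih : ∑ i ∈ Finset.Icc 1 a, (n i).choose (i + 1) ≤ a ∧
          ∑ z ∈ Finset.range (∑ i ∈ Finset.Icc 1 a, (n i).choose (i + 1)), (a + 1 - z) ≤
            ∑ i ∈ Finset.Icc 1 a, (n i).choose i := by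
        rcases hle with rfl | hle
        · simp
        · exact ih (hn.mono (Set.Icc_subset_Icc_right (Nat.le_succ a))) hle
      rw [Finset.sum_Icc_succ_top (by omega), Finset.sum_Icc_succ_top (by omega), h,
        Nat.choose_self, Nat.choose_succ_self_right, sum_range_succ_sub]
      omega

lemma choose_two_eq (a : ℕ) : (a + 2).choose a = (a + 2).choose 2 :=
  Nat.choose_symm_add

/-- If the leading term of the Macaulay expansion in degree `a + 1` is at least `a + 3`, and the
number represented is at most that of all forms in three variables, then both are equal. -/
lemma expansion_of_le {a : ℕ} {n : ℕ → ℕ} (hn : a + 3 ≤ n (a + 1))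
    (h : ∑ i ∈ Finset.Icc 1 (a + 1), (n i).choose i ≤ (a + 3).choose 2) :
    ∑ i ∈ Finset.Icc 1 (a + 1), (n i).choose i = (a + 3).choose 2 ∧
      ∑ i ∈ Finset.Icc 1 (a + 1), (n i + 1).choose (i + 1) = (a + 4).choose 2 := by
  rw [Finset.sum_Icc_succ_top (by omega)] at h
  have h1 : (a + 3).choose 2 ≤ (n (a + 1)).choose (a + 1) := by
    rw [← choose_two_eq (a + 1)]
    exact Nat.choose_le_choose _ hn
  -- A larger leading entry would give a binomial exceeding `(a + 3).choose 2`; with equality,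
  -- nothing is left for the lower terms.
  have htop : n (a + 1) = a + 3 := by
    by_contra hne
    have h2 : (a + 4).choose (a + 1) ≤ (n (a + 1)).choose (a + 1) :=
      Nat.choose_le_choose _ (by omega)
    have h4 : (a + 3).choose (a + 1) = (a + 3).choose 2 := choose_two_eq (a + 1)
    rw [Nat.choose_succ_succ' (a + 3) a, h4] at h2
    have h3 : 0 < (a + 3).choose a := Nat.choose_pos (by omega)
    omega
  have hz : ∑ i ∈ Finset.Icc 1 a, (n i).choose i = 0 := by omega
  have hz' : ∑ i ∈ Finset.Icc 1 a, (n i + 1).choose (i + 1) = 0 := by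
    rw [Finset.sum_eq_zero_iff] at hz ⊢
    intro i hi
    have := Nat.choose_eq_zero_iff.1 (hz i hi)
    exact Nat.choose_eq_zero_of_lt (by omega)
  rw [Finset.sum_Icc_succ_top (by omega), Finset.sum_Icc_succ_top (by omega), hz, hz', htop,
    zero_add, zero_add]
  exact ⟨choose_two_eq (a + 1), choose_two_eq (a + 2)⟩

/-! ### Bounds on `δ` and `b` forced by Macaulay growth -/

lemma choose_two_succ (a : ℕ) : (a + 1).choose 2 = a.choose 2 + a := by
  rw [Nat.choose_succ_succ' a 1, Nat.choose_one_right, add_comm]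

/-- Otherwise `b ^ 2 ≥ C ^ 2` with `C = (k + 3).choose 2 = (k + 3)(k + 2) / 2`, whereas `δ * s k ≤
(k + 3) * s k = C (k + 3)(k + 1) / 3`, which is smaller. -/
lemma lt_choose_of_sq_lt {δ k b : ℕ} (hδ : δ ≤ k + 3) (h : b ^ 2 < δ * s k) :
    b < (k + 3).choose 2 := by
  by_contra! hb
  have h1 : (k + 3).choose 3 * 3 = (k + 3).choose 2 * (k + 1) := Nat.choose_succ_right_eq (k + 3) 2
  have h2 : (k + 3).choose 2 * 2 = (k + 3) * (k + 2) := by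
    have := Nat.choose_succ_right_eq (k + 3) 1
    simpa using this
  have h3 : δ * s k ≤ (k + 3) * (k + 3).choose 3 := Nat.mul_le_mul_right _ hδ
  have h4 : (k + 3).choose 2 ^ 2 ≤ b ^ 2 := Nat.pow_le_pow_left hb 2
  have h5 : 0 < (k + 3).choose 2 := Nat.choose_pos (by omega)
  nlinarith

/-- The growth of `b` in degree `k + 1` by `δ` forces `b` to be
at least the Hilbert function of a plane curve of degree `δ`. -/
lemma bounds_of_expansion {δ k b : ℕ} {n : ℕ → ℕ} (hn : StrictMonoOn n (Set.Icc 1 (k + 1)))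
    (hb : b ≤ (k + 3).choose 2) (hsum : b = ∑ i ∈ Finset.Icc 1 (k + 1), (n i).choose i)
    (hgrow : b + δ ≤ ∑ i ∈ Finset.Icc 1 (k + 1), (n i + 1).choose (i + 1))
    (h : b ^ 2 < δ * s k) :
    δ ≤ k + 1 ∧ b < (k + 3).choose 2 ∧ ∑ z ∈ Finset.range δ, (k + 2 - z) ≤ b := by
  rcases le_or_gt (k + 3) (n (k + 1)) with htop | htop
  -- Here `b` would be the full dimension `(k + 3).choose 2` and `δ ≤ k + 3`, which the failure of
  -- log-concavity excludes.
  · obtain ⟨h1, h2⟩ := expansion_of_le htop (hsum ▸ hb)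
    have : (k + 4).choose 2 = (k + 3).choose 2 + (k + 3) := choose_two_succ (k + 3)
    have := lt_choose_of_sq_lt (δ := δ) (k := k) (b := b) (by omega) h
    omega
  · obtain ⟨h1, h2⟩ := growth_le_of_le hn (by omega)
    rw [sum_choose_succ_succ, ← hsum] at hgrow
    refine ⟨by omega, lt_choose_of_sq_lt (by omega) h, hsum ▸ le_trans ?_ h2⟩
    exact Finset.sum_le_sum_of_subset (Finset.range_subset_range.2 (by omega))

lemma le_choose_of_expansion {k b : ℕ} {n : ℕ → ℕ} (hk : 1 ≤ k)
    (hn : StrictMonoOn n (Set.Icc 1 k))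
    (hsum : (k + 2).choose 2 = ∑ i ∈ Finset.Icc 1 k, (n i).choose i)
    (hgrow : b ≤ ∑ i ∈ Finset.Icc 1 k, (n i + 1).choose (i + 1)) : b ≤ (k + 3).choose 2 := by
  obtain ⟨a, rfl⟩ : ∃ a, k = a + 1 := ⟨k - 1, by omega⟩
  rcases le_or_gt (a + 3) (n (a + 1)) with htop | htop
  · exact hgrow.trans (expansion_of_le htop hsum.ge).2.le
  -- Uniqueness of Macaulay expansions would rule this case out; the crude growth bound `a + 1`
  -- suffices and avoids it.
  · have h1 := (growth_le_of_le hn (by omega)).1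
    rw [sum_choose_succ_succ, ← hsum] at hgrow
    have : (a + 1 + 3).choose 2 = (a + 1 + 2).choose 2 + (a + 1 + 2) :=
      choose_two_succ (a + 1 + 2)
    omega

/-- Existence of Macaulay expansions below the number of all forms in three variables, together
with the growth they allow. -/
lemma exists_expansion {a v : ℕ} (hv : v < (a + 2).choose 2) :
    ∃ n : ℕ → ℕ, StrictMonoOn n (Set.Icc 1 a) ∧ (∀ i ∈ Set.Icc 1 a, n i ≤ i + 1) ∧
      v = ∑ i ∈ Finset.Icc 1 a, (n i).choose i ∧
      ∀ δ, ∑ z ∈ Finset.range δ, (a + 1 - z) ≤ v →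
        v + δ ≤ ∑ i ∈ Finset.Icc 1 a, (n i + 1).choose (i + 1) := by
  induction a generalizing v with
  | zero =>
    obtain rfl : v = 0 := by simpa using hv
    refine ⟨id, strictMono_id.strictMonoOn _, by simp, by simp, fun δ hδ => ?_⟩
    rcases δ with _ | δ
    · simp
    · rw [Finset.sum_range_succ'] at hδ
      omega
  | succ a ih =>
    rcases le_or_gt (a + 2) v with hav | hav
    -- Greedy choice: the leading entry `a + 2` uses up `a + 2` of `v` and one unit of `δ`.
    · have hc : (a + 1 + 2).choose 2 = (a + 2).choose 2 + (a + 2) := choose_two_succ (a + 2)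
      obtain ⟨n, hn, hle, hsum, hgrow⟩ := ih (v := v - (a + 2)) (by omega)
      have hcongr : ∀ g : ℕ → ℕ → ℕ,
          ∑ i ∈ Finset.Icc 1 (a + 1), g (Function.update n (a + 1) (a + 2) i) i =
            ∑ i ∈ Finset.Icc 1 a, g (n i) i + g (a + 2) (a + 1) := by
        intro g
        rw [Finset.sum_Icc_succ_top (by omega), Function.update_self]
        congr 1
        refine Finset.sum_congr rfl fun i hi => ?_
        rw [Finset.mem_Icc] at hi
        rw [Function.update_of_ne (by omega)]
      refine ⟨Function.update n (a + 1) (a + 2), ?_, ?_, ?_, ?_⟩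
      · intro i hi j hj hij
        have hi' : i ∈ Set.Icc 1 a := ⟨hi.1, by have := hj.2; omega⟩
        rw [Function.update_of_ne (by have := hi'.2; omega)]
        rcases hj.2.lt_or_eq with h | h
        · rw [Function.update_of_ne (by omega)]
          exact hn hi' ⟨hj.1, by omega⟩ hij
        · rw [h, Function.update_self]
          have := hle i hi'
          have := hi'.2
          omega
      · intro i hi
        rcases hi.2.lt_or_eq with h | h
        · rw [Function.update_of_ne (by omega)]
          exact hle i ⟨hi.1, by omega⟩
        · rw [h, Function.update_self]
      · rw [hcongr fun x i => x.choose i, ← hsum, Nat.choose_succ_self_right]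
        omega
      · intro δ hδ
        rw [hcongr fun x i => (x + 1).choose (i + 1), Nat.choose_succ_self_right]
        rcases δ with _ | δ
        · have := hgrow 0 (by simp)
          omega
        · rw [sum_range_succ_sub] at hδ
          have := hgrow δ (by omega)
          omega
    -- For `v ≤ a + 1`, the top `v` indices get `n i = i`, contributing `1` each, and the others `n
    -- i = i - 1`, contributing `0`. No positive `δ` meets the hypothesis, whose first summand is
    -- already `a + 2`.
    · have hcount : ∑ i ∈ Finset.Icc 1 (a + 1), (if a + 1 < i + v then 1 else 0) = v := by
        rw [Finset.sum_boole]
        have : (Finset.Icc 1 (a + 1)).filter (fun i => a + 1 < i + v) =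
            Finset.Icc (a + 2 - v) (a + 1) := by
          ext i
          simp only [Finset.mem_filter, Finset.mem_Icc]
          omega
        rw [this, Nat.card_Icc, Nat.cast_id]
        omega
      refine ⟨fun i => if a + 1 < i + v then i else i - 1, ?_, ?_, ?_, ?_⟩
      · intro i hi j hj hij
        have := hi.1
        dsimp only
        split_ifs <;> omega
      · intro i _
        dsimp only
        split_ifs <;> omega
      · conv_lhs => rw [← hcount]
        refine Finset.sum_congr rfl fun i hi => ?_
        rw [Finset.mem_Icc] at hi
        dsimp only
        split_ifs
        · rw [Nat.choose_self]
        · rw [Nat.choose_eq_zero_of_lt (by omega)]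
      · intro δ hδ
        have hδ0 : δ = 0 := by
          rcases δ with _ | δ
          · rfl
          · rw [sum_range_succ_sub] at hδ
            omega
        rw [hδ0, add_zero]
        conv_lhs => rw [← hcount]
        refine Finset.sum_le_sum fun i _ => ?_
        dsimp only
        split_ifs
        · rw [Nat.choose_self]
        · exact Nat.zero_le _

/-! ### From the SI condition on `H` to numerical bounds, and back for the extension -/

lemma firstDiff_symSeq {m : ℕ} (d : ℕ → ℕ) {t : ℕ} (ht : t ≤ m) :
    firstDiff (symSeq m d) t = d t := by
  rcases t with _ | t
  · simp [firstDiff, symSeq]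
  · rw [firstDiff, symSeq, symSeq, if_pos ht, if_pos (by omega), Finset.sum_range_succ _ (t + 1)]
    push_cast
    ring

/-- The numerical conditions on `(δ, k, b)` that make the extended sequence an SI sequence. -/
lemma IsNonLogConcaveTriple.bounds {δ k b : ℕ} (hT : IsNonLogConcaveTriple δ k b) :
    δ ≤ k + 1 ∧ b < (k + 3).choose 2 ∧ ∑ z ∈ Finset.range δ, (k + 2 - z) ≤ b := by
  obtain ⟨⟨-, -, h1, -, -, -, hM⟩, hlt⟩ := hT
  have hd : ∀ t ≤ k + 2, firstDiff (baseSeq δ k b) t = baseDiff δ k b t := fun t ht =>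
    firstDiff_symSeq _ ht
  have hm : (2 * k + 4) / 2 = k + 2 := by omega
  rw [hm] at hM
  have hb : b ≤ (k + 3).choose 2 := by
    -- Macaulay's condition says nothing in degree `0`, so for `k = 0` the value of `b` is read off
    -- from `h_1 = 4`.
    rcases Nat.eq_zero_or_pos k with rfl | hk
    · have : b = 3 := by
        simp [baseSeq, symSeq, baseDiff, Finset.sum_range_succ] at h1
        omega
      simp [this, Nat.choose]
    · obtain ⟨n, ⟨hn, hsum⟩, hgrow⟩ := hM k hk (by omega)
      rw [hd k (by omega)] at hsum
      rw [hd (k + 1) (by omega)] at hgrow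
      simp only [baseDiff, le_refl, if_true] at hsum
      simp only [baseDiff, if_true, if_neg (show ¬ k + 1 ≤ k by omega)] at hgrow
      exact le_choose_of_expansion hk hn (by exact_mod_cast hsum) (by exact_mod_cast hgrow)
  obtain ⟨n, ⟨hn, hsum⟩, hgrow⟩ := hM (k + 1) (by omega) (by omega)
  rw [hd (k + 1) (by omega)] at hsum
  rw [hd (k + 1 + 1) (by omega)] at hgrow
  simp only [baseDiff, if_true, if_neg (show ¬ k + 1 ≤ k by omega)] at hsum
  simp only [baseDiff, if_neg (show ¬ k + 1 + 1 ≤ k by omega),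
    if_neg (show ¬ k + 1 + 1 = k + 1 by omega)] at hgrow
  exact bounds_of_expansion hn hb (by exact_mod_cast hsum) (by exact_mod_cast hgrow) hlt

lemma isMacaulaySequence_extSeq {δ k b : ℕ} (ℓ : ℕ) (hδ : δ ≤ k + 1) (hb : b < (k + 3).choose 2)
    (hbδ : ∑ z ∈ Finset.range δ, (k + 2 - z) ≤ b) :
    IsMacaulaySequence (k + ℓ + 2) (firstDiff (extSeq δ k b ℓ)) := by
  have hd : ∀ t ≤ k + ℓ + 2, firstDiff (extSeq δ k b ℓ) t = extDiff δ k b t := fun t ht =>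
    firstDiff_symSeq _ ht
  refine ⟨by rw [hd 0 (by omega)]; simp [extDiff], fun i hi => by rw [hd i hi]; positivity, ?_⟩
  intro a ha ham
  rw [hd a (by omega), hd (a + 1) (by omega)]
  rcases le_or_gt a k with hak | hak
  · obtain ⟨c, rfl⟩ : ∃ c, a = c + 1 := ⟨a - 1, by omega⟩
    have hcongr : ∀ g : ℕ → ℕ → ℕ, (∀ i, 1 ≤ i → g (i - 1) i = 0) →
        ∑ i ∈ Finset.Icc 1 (c + 1), g (if i = c + 1 then c + 3 else i - 1) i =
          g (c + 3) (c + 1) := by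
      intro g hg
      rw [Finset.sum_Icc_succ_top (by omega), if_pos rfl, Finset.sum_eq_zero, zero_add]
      intro i hi
      rw [Finset.mem_Icc] at hi
      rw [if_neg (by omega), hg i hi.1]
    -- With `a = c + 1`, the expansion is the single binomial `(a + 2).choose a`; the entries `i -
    -- 1` only pad with zeros.
    refine ⟨fun i => if i = c + 1 then c + 3 else i - 1, ⟨?_, ?_⟩, ?_⟩
    · intro i hi j hj hij
      have := hi.1
      have := hj.2
      dsimp only
      split_ifs <;> omega
    · have h := hcongr (fun x i => x.choose i) fun i hi => Nat.choose_eq_zero_of_lt (by omega)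
      rw [choose_two_eq (c + 1)] at h
      rw [extDiff, if_pos hak, ← h]
      push_cast
      rfl
    · have h := hcongr (fun x i => (x + 1).choose (i + 1)) fun i hi =>
        Nat.choose_eq_zero_of_lt (by omega)
      rw [choose_two_eq (c + 2)] at h
      have hle : extDiff δ k b (c + 1 + 1) ≤ (c + 4).choose 2 := by
        unfold extDiff
        split_ifs with hc
        · exact le_rfl
        · obtain rfl : k = c + 1 := by omega
          simpa using hb.le
      rw [← h] at hle
      exact_mod_cast hle
  · obtain ⟨t, rfl⟩ : ∃ t, a = k + 1 + t := ⟨a - (k + 1), by omega⟩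
    -- Each step adds `δ ≤ k + 1` on the left and more than that on the right.
    have hv : b + t * δ < (k + 1 + t + 2).choose 2 := by
      clear ham hak ha
      induction t with
      | zero => simpa using hb
      | succ t ih =>
        have := choose_two_succ (k + 1 + t + 2)
        rw [show k + 1 + (t + 1) + 2 = k + 1 + t + 2 + 1 by ring, add_mul]
        omega
    -- The lower bound on `b` also grows by exactly `δ` per degree, so it persists for `b + t * δ`.
    have hs : ∑ z ∈ Finset.range δ, (k + 1 + t + 1 - z) =
        ∑ z ∈ Finset.range δ, (k + 2 - z) + t * δ := by
      rw [mul_comm, ← smul_eq_mul, ← Finset.card_range δ, ← Finset.sum_const,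
        Finset.card_range, ← Finset.sum_add_distrib]
      refine Finset.sum_congr rfl fun z hz => ?_
      have := Finset.mem_range.1 hz
      omega
    obtain ⟨n, hn, -, hsum, hgrow⟩ := exists_expansion hv
    have h1 : extDiff δ k b (k + 1 + t) = b + t * δ := by
      rw [extDiff, if_neg (by omega), Nat.add_sub_cancel_left]
    have h2 : extDiff δ k b (k + 1 + t + 1) = b + t * δ + δ := by
      rw [extDiff, if_neg (by omega), add_assoc (k + 1), Nat.add_sub_cancel_left]
      ring
    refine ⟨n, ⟨hn, ?_⟩, ?_⟩
    · rw [h1]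
      exact_mod_cast hsum
    · rw [h2]
      exact_mod_cast hgrow δ (by omega)

end GorSeq

/-! ### The extended sequence -/

namespace GorSeq

lemma symSeq_of_le {m : ℕ} (d : ℕ → ℕ) {i : ℕ} (hi : i ≤ m) :
    symSeq m d i = ∑ t ∈ Finset.range (i + 1), d t :=
  if_pos hi

lemma symSeq_symm (m : ℕ) (d : ℕ → ℕ) {i : ℕ} (hi : i ≤ 2 * m) :
    symSeq m d i = symSeq m d (2 * m - i) := by
  rcases lt_trichotomy i m with h | rfl | h
  · rw [symSeq_of_le d h.le, symSeq, if_neg (by omega), if_pos (by omega),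
      show 2 * m - (2 * m - i) = i by omega]
  · rw [show 2 * i - i = i by omega]
  · rw [symSeq_of_le d (show 2 * m - i ≤ m by omega), symSeq, if_neg (by omega), if_pos hi]

lemma hasSocleDegree_symSeq (m : ℕ) {d : ℕ → ℕ} (hd : d 0 ≠ 0) :
    HasSocleDegree (symSeq m d) (2 * m) := by
  refine ⟨?_, fun i hi => ?_⟩
  · rw [symSeq_symm m d le_rfl, Nat.sub_self, symSeq_of_le d (Nat.zero_le m)]
    simpa using hd
  · rw [symSeq, if_neg (by omega), if_neg (by omega)]

lemma extSeq_eq_baseSeq (δ k b ℓ : ℕ) {i : ℕ} (hi : i ≤ k + 2) :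
    extSeq δ k b ℓ i = baseSeq δ k b i := by
  rw [extSeq, baseSeq, symSeq_of_le _ (by omega), symSeq_of_le _ hi]
  refine Finset.sum_congr rfl fun t ht => ?_
  rw [Finset.mem_range] at ht
  unfold extDiff baseDiff
  split_ifs with h1 h2
  · rfl
  · simp [h2]
  · rw [show t - (k + 1) = 1 by omega, one_mul]

lemma extSeq_self (δ k b ℓ : ℕ) : extSeq δ k b ℓ k = s k := by
  rw [extSeq, symSeq_of_le _ (by omega), s]
  have : ∑ t ∈ Finset.range (k + 1), extDiff δ k b t =
      ∑ t ∈ Finset.range (k + 1), (t + 2).choose 2 :=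
    Finset.sum_congr rfl fun t ht => if_pos (Nat.lt_succ_iff.1 (Finset.mem_range.1 ht))
  rw [this]
  exact Nat.sum_range_add_choose k 2

lemma extSeq_succ (δ k b : ℕ) {ℓ u : ℕ} (hu : u ≤ ℓ + 1) :
    extSeq δ k b ℓ (k + (u + 1)) = extSeq δ k b ℓ (k + u) + (b + u * δ) := by
  rw [extSeq, symSeq_of_le _ (by omega), symSeq_of_le _ (by omega), ← add_assoc k u 1,
    Finset.sum_range_succ _ (k + u + 1), extDiff, if_neg (by omega),
    show k + u + 1 - (k + 1) = u by omega]

lemma extSeq_add (δ k b : ℕ) {ℓ u : ℕ} (hu : u ≤ ℓ + 2) :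
    extSeq δ k b ℓ (k + u) = s k + b * u + δ * ∑ ν ∈ Finset.Icc 1 (u - 1), ν := by
  induction u with
  | zero => simpa using extSeq_self δ k b ℓ
  | succ u ih =>
    rw [extSeq_succ δ k b (by omega), ih (by omega)]
    rcases u with _ | u
    · simp
    · rw [Nat.add_sub_cancel, Nat.add_sub_cancel, Finset.sum_Icc_succ_top (by omega)]
      ring

lemma isSISequence_extSeq {δ k b : ℕ} (hT : IsNonLogConcaveTriple δ k b) (ℓ : ℕ) :
    IsSISequence 4 (2 * k + 4 + 2 * ℓ) (extSeq δ k b ℓ) := by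
  obtain ⟨hδ, hb, hbδ⟩ := hT.bounds
  have hj : 2 * k + 4 + 2 * ℓ = 2 * (k + ℓ + 2) := by ring
  rw [hj]
  refine ⟨hasSocleDegree_symSeq _ (by simp [extDiff]), ?_, ?_, fun i hi => symSeq_symm _ _ hi, ?_⟩
  · rw [extSeq_eq_baseSeq δ k b ℓ (by omega)]
    exact hT.1.2.1
  · rw [extSeq_eq_baseSeq δ k b ℓ (by omega)]
    exact hT.1.2.2.1
  · rw [Nat.mul_div_cancel_left _ (by omega)]
    exact isMacaulaySequence_extSeq ℓ hδ hb hbδ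

lemma isGorensteinSequence_extSeq (F : Type*) [Field F] [Infinite F] {δ k b : ℕ}
    (hT : IsNonLogConcaveTriple δ k b) (ℓ : ℕ) :
    IsGorensteinSequence F 4 (extSeq δ k b ℓ) := by
  obtain ⟨hδ, hb, hbδ⟩ := hT.bounds
  exact ⟨(isSISequence_extSeq hT ℓ).2.2.1, exists_gorenstein_extSeq F ℓ (by omega) hb.le hbδ⟩

/-- The `2 × 2` minors measuring the failure of log-concavity when `δ = 1`. -/
lemma extSeq_minor (k b : ℕ) {ℓ u : ℕ} (hu : u ≤ ℓ) :
    (extSeq 1 k b ℓ (k + u) : ℤ) * extSeq 1 k b ℓ (k + u + 2) - (extSeq 1 k b ℓ (k + u + 1) : ℤ) ^ 2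
      = extSeq 1 k b ℓ (k + u) - ((b : ℤ) + u) ^ 2 := by
  rw [add_assoc k u 2, add_assoc k u 1, extSeq_succ 1 k b (u := u + 1) (by omega),
    extSeq_succ 1 k b (u := u) (by omega)]
  push_cast
  ring

/-- Induction on `u`: the entry gains `b + u` while the subtracted square gains `2 (b + u) + 1`. -/
lemma extSeq_minor_eq (k b : ℕ) {ℓ u : ℕ} (hu : u ≤ ℓ) :
    (extSeq 1 k b ℓ (k + u) : ℤ) * extSeq 1 k b ℓ (k + u + 2) - (extSeq 1 k b ℓ (k + u + 1) : ℤ) ^ 2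
      = s k - (b : ℤ) ^ 2 - ∑ ν ∈ Finset.Icc 1 u, ((b : ℤ) + ν) := by
  rw [extSeq_minor k b hu]
  induction u with
  | zero => simp [extSeq_self]
  | succ u ih =>
    have := ih (by omega)
    rw [extSeq_succ 1 k b (by omega), Finset.sum_Icc_succ_top (by omega)]
    push_cast
    linarith

lemma two_mul_sum_Icc_add (b u : ℕ) :
    2 * ∑ ν ∈ Finset.Icc 1 u, ((b : ℤ) + ν) = 2 * b * u + u * (u + 1) := by
  induction u with
  | zero => simp
  | succ u ih =>
    rw [Finset.sum_Icc_succ_top (by omega), mul_add, ih]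
    push_cast
    ring

/-- The minors weakly decrease in `u`, so the hypothesis, which is positivity of the one at `u = ℓ`,
makes them all positive. Doubling clears the rational denominator. -/
lemma not_logConcaveAt_extSeq {k b ℓ : ℕ}
    (h : (b * ℓ + ℓ * (ℓ + 1) / 2 : ℚ) < (s k : ℚ) - (b : ℚ) ^ 2) {i : ℕ}
    (hi : i ∈ Finset.Icc (k + 1) (k + ℓ + 1)) : ¬ LogConcaveAt (extSeq 1 k b ℓ) i := by
  rw [Finset.mem_Icc] at hi
  obtain ⟨u, rfl⟩ : ∃ u, i = k + u + 1 := ⟨i - (k + 1), by omega⟩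
  have hu : u ≤ ℓ := by omega
  have hD := extSeq_minor_eq k b hu
  have h2 := two_mul_sum_Icc_add b u
  have h' : (2 * b * ℓ + ℓ * (ℓ + 1) : ℤ) < 2 * (s k - (b : ℤ) ^ 2) := by
    have : (2 * b * ℓ + ℓ * (ℓ + 1) : ℚ) < 2 * (s k - (b : ℚ) ^ 2) := by linarith
    exact_mod_cast this
  have hmono : (2 * b * u + u * (u + 1) : ℤ) ≤ 2 * b * ℓ + ℓ * (ℓ + 1) := by
    have : 2 * b * u + u * (u + 1) ≤ 2 * b * ℓ + ℓ * (ℓ + 1) := by gcongr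
    exact_mod_cast this
  rw [LogConcaveAt, not_le, Nat.add_sub_cancel]
  have hpos : (extSeq 1 k b ℓ (k + u + 1) : ℤ) ^ 2 <
      extSeq 1 k b ℓ (k + u) * extSeq 1 k b ℓ (k + u + 2) := by linarith
  exact_mod_cast hpos

end GorSeq

theorem proposition3p4 (F : Type*) [Field F] [Infinite F] (δ k b ℓ : ℕ)
    (hT : GorSeq.IsNonLogConcaveTriple δ k b) (hℓ : 0 < ℓ) :
    -- `H'(ℓ)` extends `H` as prescribed
    (∀ i ≤ k + 2, GorSeq.extSeq δ k b ℓ i = GorSeq.baseSeq δ k b i) ∧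
    (∀ t ≤ ℓ + 1, GorSeq.firstDiff (GorSeq.extSeq δ k b ℓ) (k + 1 + t) = b + t * δ) ∧
    -- `H'(ℓ)` is a codimension four SI sequence and Gorenstein sequence, of socle degree `2k+4+2ℓ`
    GorSeq.HasSocleDegree (GorSeq.extSeq δ k b ℓ) (2 * k + 4 + 2 * ℓ) ∧
    GorSeq.IsSISequence 4 (2 * k + 4 + 2 * ℓ) (GorSeq.extSeq δ k b ℓ) ∧
    GorSeq.IsGorensteinSequence F 4 (GorSeq.extSeq δ k b ℓ) ∧
    -- the entries of `H'(ℓ)`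
    (∀ u ∈ Finset.Icc 1 (ℓ + 2), GorSeq.extSeq δ k b ℓ (k + u) =
      GorSeq.s k + b * u + δ * ∑ ν ∈ Finset.Icc 1 (u - 1), ν) ∧
    (δ = 1 →
      (∀ u ≤ ℓ,
        (GorSeq.extSeq δ k b ℓ (k + u) : ℤ) * GorSeq.extSeq δ k b ℓ (k + u + 2)
            - (GorSeq.extSeq δ k b ℓ (k + u + 1) : ℤ) ^ 2
          = GorSeq.s k - (b : ℤ) ^ 2 - ∑ ν ∈ Finset.Icc 1 u, ((b : ℤ) + ν)) ∧
      -- the first differences of these numbers are linear in `u`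
      (∀ u < ℓ,
        ((GorSeq.extSeq δ k b ℓ (k + (u + 1)) : ℤ) * GorSeq.extSeq δ k b ℓ (k + (u + 1) + 2)
            - (GorSeq.extSeq δ k b ℓ (k + (u + 1) + 1) : ℤ) ^ 2)
          - ((GorSeq.extSeq δ k b ℓ (k + u) : ℤ) * GorSeq.extSeq δ k b ℓ (k + u + 2)
            - (GorSeq.extSeq δ k b ℓ (k + u + 1) : ℤ) ^ 2)
          = -((b : ℤ) + (u + 1))) ∧
      ((b * ℓ + ℓ * (ℓ + 1) / 2 : ℚ) < (GorSeq.s k : ℚ) - (b : ℚ) ^ 2 →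
        ∀ i ∈ Finset.Icc (k + 1) (k + ℓ + 1),
          ¬ GorSeq.LogConcaveAt (GorSeq.extSeq δ k b ℓ) i)) := by
  refine ⟨fun i hi => GorSeq.extSeq_eq_baseSeq δ k b ℓ hi, fun t ht => ?_,
    (GorSeq.isSISequence_extSeq hT ℓ).1, GorSeq.isSISequence_extSeq hT ℓ,
    GorSeq.isGorensteinSequence_extSeq F hT ℓ,
    fun u hu => GorSeq.extSeq_add δ k b (Finset.mem_Icc.1 hu).2, ?_⟩
  · rw [GorSeq.extSeq, GorSeq.firstDiff_symSeq _ (by omega), GorSeq.extDiff, if_neg (by omega),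
      Nat.add_sub_cancel_left]
    push_cast
    rfl
  · rintro rfl
    refine ⟨fun u hu => GorSeq.extSeq_minor_eq k b hu, fun u hu => ?_,
      fun h i hi => GorSeq.not_logConcaveAt_extSeq h hi⟩
    rw [GorSeq.extSeq_minor k b (u := u + 1) (by omega), GorSeq.extSeq_minor k b hu.le,
      GorSeq.extSeq_succ 1 k b (by omega)]
    push_cast
    ring
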